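/- Let $A$ be an array of length $n=2^d$, $d\in\{0,1,2,\dots\}$, with entries from a linearly ordered set, sorted in non-decreasing order, and let $e$ be an element that occurs in $A$. A search algorithm has access to $A$ and $e$ only through adaptive queries: a query to an index $i$ returns one of `$<$', `$>$', `$=$', claiming that $A[i]<e$, $A[i]>e$ or $A[i]=e$, respectively. The outcomes are chosen by an adaptive adversary; an outcome whose claim is wrong is called a lie, and repeated queries to the same index may return different outcomes. The outcome `$=$' is never a lie (only queries to $e$ may yield `$=$', but they may also yield the lies `$<$' or `$>$'). Let $k_{\mathrm{lies}}\ge 0$ be an integer that bounds the number of queries with a wrong outcome. Theorem. For every real $c\ge 1$ and every $n=2^d$ there is a deterministic search algorithm, which depends neither on $k_{\mathrm{lies}}$ nor on $A$, $e$ or the adversary, such that for all $A$, $e$, $k_{\mathrm{lies}}$ and every adversary as above, the algorithm stops and reports an index $i$ with $A[i]=e$ after at most $$\Bigl(1+\frac1c\Bigr)\log_2 n+(2c+2)\,k_{\mathrm{lies}}$$ queries in total, except that in the case where both $k_{\mathrm{lies}}=0$ and $c>\log_2 n$ it may make at most one query more than this. -/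

import Mathlib

namespace NoisySearch

/-- The outcome of a query to an index `i` of an array `A` with target `e`:
`lt` claims `A i < e`, `gt` claims `A i > e`, and `eq` claims `A i = e`. -/
inductive Outcome where
  | lt
  | gt
  | eq

/-- An outcome `q` reported for index `i` is a lie if the claim it makes is wrong. -/
def IsLie {α : Type*} [LinearOrder α] {n : ℕ} (A : Fin n → α) (e : α) (i : Fin n) :
    Outcome → Prop
  | .lt => ¬ A i < e
  | .gt => ¬ A i > e
  | .eq => ¬ A i = e

/-- The queries made so far with their outcomes, most recent first. -/
abbrev History (n : ℕ) := List (Fin n × Outcome)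

/-- What a search algorithm does next: query an index, or stop and report an index. -/
inductive Action (n : ℕ) where
  | query (i : Fin n)
  | report (i : Fin n)

/-- A deterministic adaptive search algorithm for arrays of length `n`. All it ever learns about
the array and the target is the outcomes of its own queries. -/
abbrev Algorithm (n : ℕ) := History n → Action n

/-- An adaptive adversary, which picks the outcome of each query knowing all that happened
before. In particular, repeated queries to one index may have different outcomes. -/
abbrev Adversary (n : ℕ) := History n → Fin n → Outcome

/-- The history after `t` steps of `alg` against `adv`; it stays the same once `alg` reports. -/
def run {n : ℕ} (alg : Algorithm n) (adv : Adversary n) : ℕ → History n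
  | 0 => []
  | t + 1 =>
    match alg (run alg adv t) with
    | .query i => (i, adv (run alg adv t) i) :: run alg adv t
    | .report _ => run alg adv t

open Classical in
/-- The number of queries in a history that had a wrong outcome. -/
noncomputable def lieCount {α : Type*} [LinearOrder α] {n : ℕ} (A : Fin n → α) (e : α)
    (h : History n) : ℕ :=
  h.countP fun p => decide (IsLie A e p.1 p.2)

/-- `adv` may answer the queries of `alg` in this way if it has `k` lies at its disposal:
only queries to (an occurrence of) `e` may yield `eq`, and at most `k` of all the queries made
have a wrong outcome. -/
def Admissible {α : Type*} [LinearOrder α] {n : ℕ} (A : Fin n → α) (e : α) (k : ℕ)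
    (alg : Algorithm n) (adv : Adversary n) : Prop :=
  (∀ h i, adv h i = .eq → A i = e) ∧ ∀ t, lieCount A e (run alg adv t) ≤ k

/-- Against `adv`, `alg` stops after at most `b` queries and reports a position of `e`. -/
def FindsWithin {α : Type*} {n : ℕ} (A : Fin n → α) (e : α)
    (alg : Algorithm n) (adv : Adversary n) (b : ℝ) : Prop :=
  ∃ (t : ℕ) (i : Fin n), alg (run alg adv t) = .report i ∧ A i = e ∧
    ((run alg adv t).length : ℝ) ≤ b

end NoisySearch

/-!
The algorithm is a multiplicative-weights search. Every index carries a weight, initially `1`,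
which is multiplied by a fixed `β < 1` by each outcome `<` or `>` that is inconsistent with `e`
standing at that index. The algorithm always queries a weighted median and stops at the first
outcome `=`.

* The total weight starts at `n`, and each outcome other than `=` multiplies it by at most
  `(1 + β) / 2`: the queried index and all indices on one side of it, together at least half of
  the weight, are discounted by `β` (`sum_reweight_le`).
* The outcomes inconsistent with a true position of `e` are lies, so its weight never drops below
  `β ^ k` (`pow_lieCount_le_weight`).

Hence `T` queries are enough as soon as `n * ((1 + β) / 2) ^ T < β ^ k` (`exists_report_of_lt`).
For `β = 2 ^ (-2 * c)` one has `1 + β ≤ 2 ^ (1 / (2 * c + 1))` (`one_add_two_rpow_le`), so that,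
with `n = 2 ^ d`, this holds whenever `(1 + 1 / (2 * c)) * d + (2 * c + 1) * k < T`. The integer
part of the claimed bound is such a `T`: for `1 ≤ k` because the coefficient `2 * c + 2` of `k`
leaves room for one extra query, and for `k = 0`, `c ≤ d` because `d / (2 * c) < ⌊d / c⌋`. In the
remaining case the extra query is part of the bound.
-/

namespace NoisySearch

/-! ### Weighted medians -/

/-- A weighted median: on either side of it lies at most half of the total weight. -/
def IsWeightedMedian {n : ℕ} (w : Fin n → ℝ) (m : Fin n) : Prop :=
  2 * ∑ i with i < m, w i ≤ ∑ i, w i ∧ 2 * ∑ i with m < i, w i ≤ ∑ i, w i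

theorem exists_isWeightedMedian {n : ℕ} (hn : 0 < n) (w : Fin n → ℝ) (hw : ∀ i, 0 ≤ w i) :
    ∃ m, IsWeightedMedian w m := by
  have hW : 0 ≤ ∑ i, w i := Finset.sum_nonneg fun i _ => hw i
  -- The median is the largest index with at most half of the weight below it.
  obtain ⟨m, hm, hmax⟩ := Set.Finite.exists_maximal
    (s := {m : Fin n | 2 * ∑ i with i < m, w i ≤ ∑ i, w i}) (Set.toFinite _)
    ⟨⟨0, hn⟩, by simpa [fun i : Fin n => not_lt.2 (Fin.mk_le_of_le_val i.val.zero_le)] using hW⟩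
  refine ⟨m, hm, ?_⟩
  have hsplit : ∑ i with i ≤ m, w i + ∑ i with m < i, w i = ∑ i, w i := by
    simpa only [not_le] using
      Finset.sum_filter_add_sum_filter_not Finset.univ (fun i => i ≤ m) w
  by_cases h : m.val + 1 < n
  · have hlt : ∑ i, w i < 2 * ∑ i with i ≤ m, w i := by
      by_contra! hle
      have : (⟨m.val + 1, h⟩ : Fin n) ≤ m := by
        refine hmax ?_ (Fin.le_def.2 (Nat.le_succ _))
        have hiff (i : Fin n) : i < ⟨m.val + 1, h⟩ ↔ i ≤ m := Nat.lt_succ_iff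
        simpa only [Set.mem_ofPred_eq, hiff] using hle
      exact absurd (Fin.le_def.1 this) (Nat.not_succ_le_self _)
    linarith
  · have hempty : (Finset.univ.filter fun i : Fin n => m < i) = ∅ := by
      refine Finset.filter_eq_empty_iff.2 fun i _ hi => ?_
      have := Fin.lt_def.1 hi
      omega
    rw [hempty]
    simpa using hW

/-! ### Weights -/

/-- Whether an outcome for the index `j` is inconsistent with the target standing at `i`. The
outcome `eq` ends the search and is never counted. -/
def Contradicts {n : ℕ} (i j : Fin n) : Outcome → Prop
  | .lt => i ≤ j
  | .gt => j ≤ i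
  | .eq => False

open Classical in
/-- The weight of the index `i` after the queries in a history: one factor `β` for each outcome
inconsistent with the target standing at `i`. -/
noncomputable def weight {n : ℕ} (β : ℝ) : History n → Fin n → ℝ
  | [], _ => 1
  | (j, o) :: h, i => (if Contradicts i j o then β else 1) * weight β h i

open Classical in
theorem weight_cons {n : ℕ} (β : ℝ) (j : Fin n) (o : Outcome) (h : History n) (i : Fin n) :
    weight β ((j, o) :: h) i = (if Contradicts i j o then β else 1) * weight β h i :=
  rfl

theorem weight_nonneg {n : ℕ} {β : ℝ} (hβ : 0 ≤ β) (h : History n) (i : Fin n) :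
    0 ≤ weight β h i := by
  induction h with
  | nil => simp [weight]
  | cons q h ih =>
    obtain ⟨j, o⟩ := q
    rw [weight_cons]
    split_ifs <;> positivity

theorem Contradicts.isLie {α : Type*} [LinearOrder α] {n : ℕ} {A : Fin n → α} (hA : Monotone A)
    {p j : Fin n} {o : Outcome} (h : Contradicts p j o) : IsLie A (A p) j o := by
  cases o with
  | lt => exact not_lt.2 (hA h)
  | gt => exact not_lt.2 (hA h)
  | eq => exact h.elim

theorem pow_lieCount_le_weight {α : Type*} [LinearOrder α] {n : ℕ} {A : Fin n → α}
    (hA : Monotone A) {β : ℝ} (hβ : 0 ≤ β) (hβ1 : β ≤ 1) (p : Fin n) (h : History n) :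
    β ^ lieCount A (A p) h ≤ weight β h p := by
  classical
  induction h with
  | nil => simp [weight, lieCount]
  | cons q h ih =>
    obtain ⟨j, o⟩ := q
    have hw := weight_nonneg hβ h p
    simp only [lieCount, List.countP_cons] at ih ⊢
    rw [weight_cons]
    by_cases hc : Contradicts p j o
    · rw [if_pos hc, if_pos (decide_eq_true (hc.isLie hA)), pow_succ']
      gcongr
    · rw [if_neg hc, one_mul]
      exact (pow_le_pow_of_le_one hβ hβ1 (Nat.le_add_right _ _)).trans ih

/-- An outcome other than `eq` for a weighted median costs at least half of the total weight a
factor `β`. -/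
theorem sum_reweight_le {n : ℕ} {β : ℝ} (hβ1 : β ≤ 1) (h : History n) {m : Fin n}
    (hm : IsWeightedMedian (weight β h) m) {o : Outcome} (ho : o ≠ .eq) :
    ∑ i, weight β ((m, o) :: h) i ≤ (1 + β) / 2 * ∑ i, weight β h i := by
  classical
  have key : ∑ i, weight β ((m, o) :: h) i =
      β * ∑ i, weight β h i + (1 - β) * ∑ i with ¬ Contradicts i m o, weight β h i := by
    rw [Finset.sum_filter, Finset.mul_sum, Finset.mul_sum, ← Finset.sum_add_distrib]
    refine Finset.sum_congr rfl fun i _ => ?_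
    rw [weight_cons]
    split_ifs <;> ring
  have half : 2 * ∑ i with ¬ Contradicts i m o, weight β h i ≤ ∑ i, weight β h i := by
    cases o with
    | lt => simpa [Contradicts] using hm.2
    | gt => simpa [Contradicts] using hm.1
    | eq => exact absurd rfl ho
  rw [key]
  nlinarith

/-! ### The search -/

/-- The multiplicative-weights search with the median rule `med`: it reports the index last
queried if the outcome was `eq`, and queries the median of the current weights otherwise. -/
noncomputable def medianSearch {n : ℕ} (β : ℝ) (med : (Fin n → ℝ) → Fin n) : Algorithm n
  | (i, .eq) :: _ => .report i
  | h => .query (med (weight β h))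

theorem medianSearch_of_head_ne_eq {n : ℕ} (β : ℝ) (med : (Fin n → ℝ) → Fin n) (h : History n)
    (hh : ∀ i l, h ≠ (i, .eq) :: l) : medianSearch β med h = .query (med (weight β h)) := by
  unfold medianSearch
  split
  · exact absurd rfl (hh _ _)
  · rfl

/-- Up to any time `t`, either the search has stopped with an outcome `eq`, or all its `t` queries
have shrunk the total weight. -/
theorem exists_report_or_sum_weight_le {n : ℕ} {β : ℝ} (hβ : 0 ≤ β) (hβ1 : β ≤ 1)
    {med : (Fin n → ℝ) → Fin n}
    (hmed : ∀ w : Fin n → ℝ, (∀ i, 0 ≤ w i) → IsWeightedMedian w (med w))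
    (adv : Adversary n) (t : ℕ) :
    (∃ s i h, run (medianSearch β med) adv s = (i, .eq) :: h ∧ adv h i = .eq ∧
      h.length + 1 ≤ t) ∨
    ((∀ i l, run (medianSearch β med) adv t ≠ (i, .eq) :: l) ∧
      (run (medianSearch β med) adv t).length = t ∧
      ∑ i, weight β (run (medianSearch β med) adv t) i ≤ n * ((1 + β) / 2) ^ t) := by
  induction t with
  | zero => right; simp [run, weight]
  | succ t ih =>
    rcases ih with ⟨s, i, h, h1, h2, h3⟩ | ⟨hne, hlen, hsum⟩
    · exact Or.inl ⟨s, i, h, h1, h2, by omega⟩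
    · set h := run (medianSearch β med) adv t with hh
      have hrun : run (medianSearch β med) adv (t + 1) =
          (med (weight β h), adv h (med (weight β h))) :: h := by
        simp only [run, ← hh, medianSearch_of_head_ne_eq β med h hne]
      by_cases heq : adv h (med (weight β h)) = .eq
      · exact Or.inl ⟨t + 1, _, h, by rw [hrun, heq], heq, by omega⟩
      · right
        rw [hrun]
        refine ⟨fun i l hcons => heq ?_, by simp [hlen], ?_⟩
        · exact congrArg Prod.snd (List.cons.inj hcons).1
        · refine (sum_reweight_le hβ1 h (hmed _ (weight_nonneg hβ h)) heq).trans ?_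
          rw [pow_succ]
          nlinarith [mul_le_mul_of_nonneg_left hsum (by linarith : 0 ≤ (1 + β) / 2)]

/-- `T` queries are enough once the total weight after `T` outcomes other than `eq` would be less
than the weight of a true position. -/
theorem exists_report_of_lt {α : Type*} [LinearOrder α] {n : ℕ} {A : Fin n → α} (hA : Monotone A)
    {e : α} (he : e ∈ Set.range A) {β : ℝ} (hβ : 0 ≤ β) (hβ1 : β ≤ 1)
    {med : (Fin n → ℝ) → Fin n}
    (hmed : ∀ w : Fin n → ℝ, (∀ i, 0 ≤ w i) → IsWeightedMedian w (med w))
    {k : ℕ} {adv : Adversary n} (hadv : Admissible A e k (medianSearch β med) adv)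
    {T : ℕ} (hT : n * ((1 + β) / 2) ^ T < β ^ k) {b : ℝ} (hb : (T : ℝ) ≤ b) :
    FindsWithin A e (medianSearch β med) adv b := by
  obtain ⟨p, rfl⟩ := he
  rcases exists_report_or_sum_weight_le hβ hβ1 hmed adv T with
    ⟨s, i, h, hrun, heq, hlen⟩ | ⟨-, -, hsum⟩
  · refine ⟨s, i, by rw [hrun]; rfl, hadv.1 h i heq, le_trans ?_ hb⟩
    rw [hrun]
    exact_mod_cast hlen
  · exfalso
    set h := run (medianSearch β med) adv T
    have h1 : β ^ k ≤ β ^ lieCount A (A p) h := pow_le_pow_of_le_one hβ hβ1 (hadv.2 T)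
    have h2 := pow_lieCount_le_weight hA hβ hβ1 p h
    have h3 : weight β h p ≤ ∑ i, weight β h i :=
      Finset.single_le_sum (fun i _ => weight_nonneg hβ h i) (Finset.mem_univ p)
    linarith

/-! ### The choice of the discount factor -/

/-- The inequality is nearly tight at `s = 3`: the linear bound `1 + log 2 / s` on `2 ^ (1 / s)`
is too weak there, so the exponential is expanded to second order. -/
theorem one_add_two_rpow_le {s : ℝ} (hs : 3 ≤ s) : 1 + (2 : ℝ) ^ (1 - s) ≤ 2 ^ (1 / s) := by
  have hs0 : 0 < s := by linarith
  have hL : 0.69 < Real.log 2 := by linarith [Real.log_two_gt_d9]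
  have h1 : 1 + Real.log 2 / s + (Real.log 2 / s) ^ 2 / 2 ≤ (2 : ℝ) ^ (1 / s) := by
    rw [Real.rpow_def_of_pos two_pos, mul_one_div]
    exact Real.quadratic_le_exp_of_nonneg (by positivity)
  have h2 : 0.69 / s + (0.69 / s) ^ 2 / 2 ≤ Real.log 2 / s + (Real.log 2 / s) ^ 2 / 2 := by
    gcongr
  have h3 : 4 * (1 + 0.69 * (s - 3)) ≤ (2 : ℝ) ^ (s - 1) := by
    have h4 : (2 : ℝ) ^ (s - 1) = 4 * 2 ^ (s - 3) := by
      rw [show s - 1 = 2 + (s - 3) by ring, Real.rpow_add two_pos]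
      norm_num
    have h5 : Real.log 2 * (s - 3) + 1 ≤ (2 : ℝ) ^ (s - 3) := by
      rw [Real.rpow_def_of_pos two_pos]
      exact Real.add_one_le_exp _
    rw [h4]
    nlinarith
  have h6 : (2 : ℝ) ^ (1 - s) ≤ 1 / (4 * (1 + 0.69 * (s - 3))) := by
    rw [show 1 - s = -(s - 1) by ring, Real.rpow_neg two_pos.le, ← one_div]
    exact one_div_le_one_div_of_le (by nlinarith) h3
  have h7 : 1 / (4 * (1 + 0.69 * (s - 3))) ≤ 0.69 / s + (0.69 / s) ^ 2 / 2 := by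
    have h8 : 0.69 / s + (0.69 / s) ^ 2 / 2 = (0.69 * s + 0.69 ^ 2 / 2) / s ^ 2 := by
      field_simp
    rw [h8, div_le_div_iff₀ (by nlinarith) (by positivity)]
    nlinarith
  linarith

/-- With discount factor `2 ^ (-2 * c)`, the condition of `exists_report_of_lt` for `2 ^ d`
indices is linear in `d` and `k`. -/
theorem two_pow_mul_pow_lt {c : ℝ} (hc : 1 ≤ c) {d k T : ℕ}
    (hT : (1 + 1 / (2 * c)) * d + (2 * c + 1) * k < T) :
    ((2 ^ d : ℕ) : ℝ) * ((1 + (2 : ℝ) ^ (-2 * c)) / 2) ^ T < ((2 : ℝ) ^ (-2 * c)) ^ k := by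
  have hs : 0 < 2 * c + 1 := by linarith
  have h1 : (1 + (2 : ℝ) ^ (-2 * c)) / 2 ≤ 2 ^ (1 / (2 * c + 1) - 1) := by
    have := one_add_two_rpow_le (s := 2 * c + 1) (by linarith)
    rw [show 1 - (2 * c + 1) = -2 * c by ring] at this
    rw [Real.rpow_sub_one two_ne_zero]
    gcongr
  have h2 : (d : ℝ) + (1 / (2 * c + 1) - 1) * T < -2 * c * k := by
    have h3 : (1 + 1 / (2 * c)) * d + (2 * c + 1) * k =
        (d + 2 * c * k) * ((2 * c + 1) / (2 * c)) := by
      field_simp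
    rw [h3, ← lt_div_iff₀ (by positivity)] at hT
    have h4 : (T : ℝ) / ((2 * c + 1) / (2 * c)) = -((1 / (2 * c + 1) - 1) * T) := by
      field_simp
      ring
    linarith
  calc ((2 ^ d : ℕ) : ℝ) * ((1 + (2 : ℝ) ^ (-2 * c)) / 2) ^ T
      ≤ 2 ^ (d : ℝ) * (2 ^ (1 / (2 * c + 1) - 1)) ^ T := by
        rw [Real.rpow_natCast]
        push_cast
        gcongr
    _ = 2 ^ ((d : ℝ) + (1 / (2 * c + 1) - 1) * T) := by
        rw [Real.rpow_add two_pos, Real.rpow_mul_natCast two_pos.le]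
    _ < 2 ^ (-2 * c * k) := Real.rpow_lt_rpow_of_exponent_lt one_lt_two h2
    _ = ((2 : ℝ) ^ (-2 * c)) ^ k := Real.rpow_mul_natCast two_pos.le _ _

end NoisySearch

theorem mainTheorem1 (c : ℝ) (hc : 1 ≤ c) (n : ℕ) (hn : ∃ d : ℕ, n = 2 ^ d) :
    ∃ alg : NoisySearch.Algorithm n,
      ∀ (α : Type*) [LinearOrder α] (A : Fin n → α) (_ : Monotone A)
        (e : α) (_ : e ∈ Set.range A) (k : ℕ) (adv : NoisySearch.Adversary n)
        (_ : NoisySearch.Admissible A e k alg adv),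
        ((1 ≤ k ∨ c ≤ Real.logb 2 n) →
          NoisySearch.FindsWithin A e alg adv
            ((1 + 1 / c) * Real.logb 2 n + (2 * c + 2) * k)) ∧
        NoisySearch.FindsWithin A e alg adv
          ((1 + 1 / c) * Real.logb 2 n + (2 * c + 2) * k + 1) := by
  open NoisySearch in
  obtain ⟨d, rfl⟩ := hn
  choose! med hmed using fun (w : Fin (2 ^ d) → ℝ) (hw : ∀ i, 0 ≤ w i) =>
    exists_isWeightedMedian (Nat.two_pow_pos d) w hw
  have : Nonempty (Fin (2 ^ d)) := ⟨⟨0, Nat.two_pow_pos d⟩⟩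
  refine ⟨medianSearch (2 ^ (-2 * c)) med, fun α _ A hA e he k adv hadv => ?_⟩
  have hlog : Real.logb 2 ((2 ^ d : ℕ) : ℝ) = d := by
    push_cast
    rw [Real.logb_pow, Real.logb_self_eq_one one_lt_two, mul_one]
  rw [hlog]
  have hβ1 : (2 : ℝ) ^ (-2 * c) ≤ 1 :=
    Real.rpow_le_one_of_one_le_of_nonpos one_le_two (by linarith)
  have finds {b : ℝ} (T : ℕ) (hT : (1 + 1 / (2 * c)) * d + (2 * c + 1) * k < T)
      (hb : (T : ℝ) ≤ b) : FindsWithin A e (medianSearch (2 ^ (-2 * c)) med) adv b :=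
    exists_report_of_lt hA he (by positivity) hβ1 hmed hadv (two_pow_mul_pow_lt hc hT) hb
  have hk : (0 : ℝ) ≤ k := k.cast_nonneg
  have hhalf : (1 + 1 / (2 * c)) * (d : ℝ) ≤ (1 + 1 / c) * d := by
    gcongr
    linarith
  refine ⟨fun h => ?_, ?_⟩
  · rcases Nat.eq_zero_or_pos k with rfl | hk1
    · have hcd : c ≤ d := h.resolve_left (by simp)
      have hx : 1 ≤ (d : ℝ) / c := (one_le_div (by linarith)).2 hcd
      -- Since `⌊x⌋ > x / 2` for `x = d / c ≥ 1`, the integer part of the bound exceeds `d + x / 2`.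
      have hx' : (1 + 1 / (2 * c)) * (d : ℝ) = d + d / c / 2 := by field_simp
      have hx'' : (1 + 1 / c) * (d : ℝ) = d + d / c := by ring
      have hfloor : 1 ≤ ⌊(d : ℝ) / c⌋₊ := Nat.one_le_floor_iff _ |>.2 hx
      have hfloor' : (1 : ℝ) ≤ ⌊(d : ℝ) / c⌋₊ := by exact_mod_cast hfloor
      have hlt := Nat.lt_floor_add_one ((d : ℝ) / c)
      have hle := Nat.floor_le (zero_le_one.trans hx)
      refine finds (d + ⌊(d : ℝ) / c⌋₊) ?_ ?_
      · rw [hx']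
        push_cast
        linarith
      · rw [hx'']
        push_cast
        linarith
    · have hk1' : (1 : ℝ) ≤ k := by exact_mod_cast hk1
      refine finds ⌊(1 + 1 / c) * (d : ℝ) + (2 * c + 2) * k⌋₊ ?_ (Nat.floor_le (by positivity))
      have := Nat.lt_floor_add_one ((1 + 1 / c) * (d : ℝ) + (2 * c + 2) * k)
      linarith
  · refine finds ⌊(1 + 1 / c) * (d : ℝ) + (2 * c + 2) * k + 1⌋₊ ?_
      (Nat.floor_le (by positivity))
    have := Nat.lt_floor_add_one ((1 + 1 / c) * (d : ℝ) + (2 * c + 2) * k + 1)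
    linarith
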